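/- A lattice polytope $P\subset\mathbb R^n$ is the convex hull of a nonempty finite subset of $\mathbb Z^n$; it is a $d$-polytope if its affine span $\operatorname{aff}P$ has dimension $d$. Let $V$ be the linear space parallel to $\operatorname{aff}P$, let $M=\mathbb Z^n\cap V$, and let $M^\vee\subset V^*$ be the lattice of linear functionals on $V$ taking integral values on $M$. The normal fan of $P$ consists of the cones $\{\varphi\in V^* : \varphi(y-x)\ge 0 \text{ for all } x\in F,\ y\in P\}$, where $F$ runs over the nonempty faces of $P$ (including $P$ itself). A cone in $V^*$ is unimodular if it is generated by a (possibly empty) subset of a $\mathbb Z$-basis of $M^\vee$, and $P$ is smooth if every cone in its normal fan is unimodular. Two lattice polytopes $P\subset\mathbb R^n$ and $P'\subset\mathbb R^{n'}$ are integrally equivalent if there is an affine map $\operatorname{aff}P\to\operatorname{aff}P'$ that maps $\mathbb Z^n\cap\operatorname{aff}P$ bijectively to $\mathbb Z^{n'}\cap\operatorname{aff}P'$ and $P$ onto $P'$. Let $d$ and $k$ be nonnegative integers. Then, among all smooth lattice $d$-polytopes $P\subset\mathbb R^n$ (for arbitrary $n$) with exactly $k$ lattice points, i.e. $|P\cap\mathbb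 Z^n|=k$, there are only finitely many integral equivalence classes. -/

import Mathlib

namespace SmoothPolytope

/-- The integer lattice `ℤⁿ` inside `ℝⁿ`. -/
def intLattice (n : ℕ) : Submodule ℤ (Fin n → ℝ) where
  carrier := {x | ∀ i, ∃ k : ℤ, x i = k}
  add_mem' := by
    intro a b ha hb i
    obtain ⟨k, hk⟩ := ha i
    obtain ⟨l, hl⟩ := hb i
    exact ⟨k + l, by simp [hk, hl]⟩
  zero_mem' := fun i => ⟨0, by simp⟩
  smul_mem' := by
    intro c x hx i
    obtain ⟨k, hk⟩ := hx i
    exact ⟨c * k, by simp [hk]⟩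

/-- A (nonempty) lattice polytope in `ℝⁿ`: the convex hull of a nonempty finite set of points
of `ℤⁿ`. -/
def IsLatticePolytope {n : ℕ} (P : Set (Fin n → ℝ)) : Prop :=
  ∃ S : Finset (Fin n → ℝ), S.Nonempty ∧ (∀ x ∈ S, x ∈ intLattice n) ∧
    P = convexHull ℝ (S : Set (Fin n → ℝ))

/-- The lattice `N = Hom(M, ℤ)`, where `M = ℤⁿ ∩ V` and `V = vectorSpan ℝ P` is the linear space
parallel to the affine span of `P`, realised as the linear functionals on `V` that take
integral values on `M`. (If `P` has full dimension then `V = ℝⁿ` and `M = ℤⁿ`.) -/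
def dualLattice {n : ℕ} (P : Set (Fin n → ℝ)) :
    Submodule ℤ (Module.Dual ℝ (vectorSpan ℝ P)) where
  carrier := {φ | ∀ v : vectorSpan ℝ P, (v : Fin n → ℝ) ∈ intLattice n → ∃ k : ℤ, φ v = k}
  add_mem' := by
    intro a b ha hb v hv
    obtain ⟨k, hk⟩ := ha v hv
    obtain ⟨l, hl⟩ := hb v hv
    exact ⟨k + l, by simp [hk, hl]⟩
  zero_mem' := fun v _ => ⟨0, by simp⟩
  smul_mem' := by
    intro c φ hφ v hv
    obtain ⟨k, hk⟩ := hφ v hv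
    exact ⟨c * k, by simp [hk]⟩

/-- The tangent cone `cone (y - x : x ∈ F, y ∈ P)` of `P` along `F`, as a cone in the linear space
parallel to the affine span of `P`. -/
def tangentCone {n : ℕ} (P F : Set (Fin n → ℝ)) : PointedCone ℝ (vectorSpan ℝ P) :=
  PointedCone.hull ℝ {v | ∃ x ∈ F, ∃ y ∈ P, (v : Fin n → ℝ) = y - x}

/-- The (inner) normal cone of `P` at `F`: the dual of the tangent cone. -/
def normalCone {n : ℕ} (P F : Set (Fin n → ℝ)) :
    PointedCone ℝ (Module.Dual ℝ (vectorSpan ℝ P)) :=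
  PointedCone.dual (Module.Dual.eval ℝ (vectorSpan ℝ P)) (tangentCone P F)

/-- The normal fan of `P`: the normal cones at the nonempty faces of `P`, including `P` itself.
(Faces of a polytope are its exposed subsets.) -/
def normalFan {n : ℕ} (P : Set (Fin n → ℝ)) :
    Set (PointedCone ℝ (Module.Dual ℝ (vectorSpan ℝ P))) :=
  {σ | ∃ F : Set (Fin n → ℝ), F.Nonempty ∧ IsExposed ℝ P F ∧ σ = normalCone P F}

/-- A cone `σ` in a real vector space `W` is unimodular with respect to a lattice `L` in `W` if it
is generated by part of a `ℤ`-basis of `L`. -/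
def IsUnimodular {W : Type*} [AddCommGroup W] [Module ℝ W] (L : Submodule ℤ W)
    (σ : PointedCone ℝ W) : Prop :=
  ∃ (m : ℕ) (b : Module.Basis (Fin m) ℤ L) (s : Set (Fin m)),
    σ = PointedCone.hull ℝ ((fun i => (b i : W)) '' s)

/-- Every cone of the normal fan is unimodular. -/
def IsSmooth {n : ℕ} (P : Set (Fin n → ℝ)) : Prop :=
  ∀ σ ∈ normalFan P, IsUnimodular (dualLattice P) σ

/-- Integral equivalence: an affine map sends `ℤⁿ ∩ aff P` bijectively onto `ℤⁿ' ∩ aff P'` and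
sends `P` onto `P'`. (An affine map between the affine spans is the same as the
restriction to `aff P` of an affine map of the ambient spaces sending `P` onto `P'`.) -/
def IntegrallyEquivalent {n n' : ℕ} (P : Set (Fin n → ℝ)) (P' : Set (Fin n' → ℝ)) : Prop :=
  ∃ f : (Fin n → ℝ) →ᵃ[ℝ] (Fin n' → ℝ),
    Set.BijOn f {x | x ∈ intLattice n ∧ x ∈ affineSpan ℝ P}
      {x | x ∈ intLattice n' ∧ x ∈ affineSpan ℝ P'} ∧
    f '' P = P'

theorem IntegrallyEquivalent.refl {n : ℕ} (P : Set (Fin n → ℝ)) : IntegrallyEquivalent P P :=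
  ⟨AffineMap.id ℝ _, by simpa using Set.bijOn_id _, by simp⟩

theorem IntegrallyEquivalent.trans {n₁ n₂ n₃ : ℕ} {P₁ : Set (Fin n₁ → ℝ)}
    {P₂ : Set (Fin n₂ → ℝ)} {P₃ : Set (Fin n₃ → ℝ)} (h : IntegrallyEquivalent P₁ P₂)
    (h' : IntegrallyEquivalent P₂ P₃) : IntegrallyEquivalent P₁ P₃ := by
  obtain ⟨f, hf, rfl⟩ := h
  obtain ⟨g, hg, rfl⟩ := h'
  exact ⟨g.comp f, by simpa using hg.comp hf, by simp [Set.image_comp]⟩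

theorem IntegrallyEquivalent.symm {n n' : ℕ} {P : Set (Fin n → ℝ)} {P' : Set (Fin n' → ℝ)}
    (hP : P.Nonempty)
    (hd : Module.finrank ℝ (vectorSpan ℝ P) = Module.finrank ℝ (vectorSpan ℝ P'))
    (h : IntegrallyEquivalent P P') : IntegrallyEquivalent P' P := by
  obtain ⟨f, hf, rfl⟩ := h
  obtain ⟨p, hp⟩ := hP
  have hmap : (vectorSpan ℝ P).map f.linear = vectorSpan ℝ (f '' P) :=
    AffineMap.map_vectorSpan f
  have hinj : Function.Injective (f.linear.domRestrict (vectorSpan ℝ P)) := by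
    rw [← LinearMap.ker_eq_bot, ← Submodule.finrank_eq_zero (R := ℝ)]
    have h1 := LinearMap.finrank_range_add_finrank_ker
      (f.linear.domRestrict (vectorSpan ℝ P))
    rw [LinearMap.range_domRestrict, hmap, ← hd] at h1
    omega
  obtain ⟨g, hg⟩ := LinearMap.exists_leftInverse_of_injective _ (LinearMap.ker_eq_bot.2 hinj)
  let g' : (Fin n' → ℝ) →ₗ[ℝ] (Fin n → ℝ) := (vectorSpan ℝ P).subtype ∘ₗ g
  let G : (Fin n' → ℝ) →ᵃ[ℝ] (Fin n → ℝ) :=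
    g'.toAffineMap.comp (AffineMap.id ℝ _ - AffineMap.const ℝ _ (f p)) + AffineMap.const ℝ _ p
  have hG : ∀ x ∈ affineSpan ℝ P, G (f x) = x := by
    intro x hx
    have hv : x - p ∈ vectorSpan ℝ P := by
      rw [← direction_affineSpan]
      exact AffineSubspace.vsub_mem_direction hx (subset_affineSpan ℝ P hp)
    have h2 : g (f.linear (x - p)) = ⟨x - p, hv⟩ :=
      LinearMap.congr_fun hg ⟨x - p, hv⟩
    have h3 : f x - f p = f.linear (x - p) := (f.linearMap_vsub x p).symm
    have h4 : G (f x) = g' (f x - f p) + p := by simp [G]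
    rw [h4, h3]
    simp only [g', LinearMap.comp_apply, h2, Submodule.subtype_apply, sub_add_cancel]
  refine ⟨G, ?_, ?_⟩
  · refine Set.BijOn.symm (f := f) ⟨?_, ?_⟩ hf
    · intro y hy
      obtain ⟨x, hx, rfl⟩ := hf.surjOn hy
      rw [hG x hx.2]
    · intro x hx
      exact hG x hx.2
  · rw [Set.image_image]
    calc (fun x => G (f x)) '' P = id '' P :=
          Set.image_congr fun x hx => hG x (subset_affineSpan ℝ P hx)
      _ = P := Set.image_id P

/-- Smooth lattice polytopes of dimension `d`, in some `ℝⁿ`, with exactly `k` lattice points. -/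
structure SmoothLatticePolytope (d k : ℕ) where
  /-- the dimension of the ambient space -/
  ambientDim : ℕ
  /-- the polytope as a set of points -/
  carrier : Set (Fin ambientDim → ℝ)
  isLatticePolytope : IsLatticePolytope carrier
  finrank_eq : Module.finrank ℝ (vectorSpan ℝ carrier) = d
  isSmooth : IsSmooth carrier
  encard_eq : {x | x ∈ carrier ∧ x ∈ intLattice ambientDim}.encard = k

/-- Integral equivalence as an equivalence relation on smooth lattice `d`-polytopes with `k`
lattice points. -/
def integralEquivalence (d k : ℕ) : Setoid (SmoothLatticePolytope d k) where
  r P Q := IntegrallyEquivalent P.carrier Q.carrier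
  iseqv :=
    { refl := fun P => IntegrallyEquivalent.refl P.carrier
      symm := by
        intro P Q h
        refine h.symm ?_ (P.finrank_eq.trans Q.finrank_eq.symm)
        obtain ⟨S, hS, -, hP⟩ := P.isLatticePolytope
        rw [hP]
        exact hS.to_set.convexHull
      trans := fun h h' => h.trans h' }

end SmoothPolytope

namespace SmoothPolytope

open Finset

/-! Smoothness makes the primitive edge directions at each vertex `v` a lattice basis, and the
tangent cone its positive orthant (`IsVertex.exists_frame`). In these coordinates the polytope is
the hull of points of `ℕᵈ`, so it suffices to bound the coordinates in terms of `d` and `k`: a box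
has only finitely many subsets.

The bound comes from the simplex method. Cross an edge of lattice length `l` from `v` to `w`, in
direction `e i`. The directions at `w` are `-e i` and vectors `e m + c • e i` with `m ≠ i`
(`VertexFrame.neighbour_edge_eq`). The edge carries `l + 1` lattice points, and the segment from `v
+ e m` to `w + e m + c • e i` carries `l + c + 1`, so `l` and `|c|` are less than `k`. Hence one
step raises a functional by at most `k` times its bound `C` on the current edges, and the next edges
have bound `d * k * C`. Each step leaves fewer of the `k` lattice points above the current value, so
at most `k` steps reach the maximum (`VertexFrame.apply_sub_le`). Applying this to the coordinates
at `v` bounds the box. -/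

theorem intLattice_sub_mem {n : ℕ} {x y : Fin n → ℝ} (hx : x ∈ intLattice n)
    (hy : y ∈ intLattice n) : x - y ∈ intLattice n :=
  Submodule.sub_mem _ hx hy

/-! ### Lattice-convex sets, vertices and frames -/

/-- A finite set of lattice points that contains every lattice point of its convex hull. -/
def IsLatticeConvex {n : ℕ} (A : Finset (Fin n → ℝ)) : Prop :=
  ∀ x, x ∈ A ↔ x ∈ convexHull ℝ (A : Set (Fin n → ℝ)) ∧ x ∈ intLattice n

/-- `v` is a vertex of the convex hull of `A`: some linear functional has a strict minimum over
`A` at `v`. -/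
def IsVertex {n : ℕ} (A : Finset (Fin n → ℝ)) (v : Fin n → ℝ) : Prop :=
  v ∈ A ∧ ∃ φ : (Fin n → ℝ) →ₗ[ℝ] ℝ, ∀ a ∈ A, a ≠ v → 0 < φ (a - v)

/-- A basis `edge` of the lattice `ℤⁿ ∩ V`, with dual functionals `coord`, that generates the
tangent cone of the convex hull of `A` at `v`. -/
structure VertexFrame {n : ℕ} (A : Finset (Fin n → ℝ)) (V : Submodule ℝ (Fin n → ℝ)) (d : ℕ)
    (v : Fin n → ℝ) where
  /-- the coordinate functionals -/
  coord : Fin d → (Fin n → ℝ) →ₗ[ℝ] ℝ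
  /-- the primitive edge directions -/
  edge : Fin d → Fin n → ℝ
  coord_edge : ∀ i j, coord i (edge j) = if i = j then 1 else 0
  edge_mem : ∀ i, edge i ∈ intLattice n
  edge_mem_span : ∀ i, edge i ∈ V
  eq_sum : ∀ x ∈ V, x = ∑ i, coord i x • edge i
  coord_int : ∀ x ∈ V, x ∈ intLattice n → ∀ i, ∃ c : ℤ, coord i x = c
  coord_nonneg : ∀ a ∈ A, ∀ i, 0 ≤ coord i (a - v)
  add_edge_mem : ∀ i, v + edge i ∈ A

theorem IsLatticeConvex.segment_mem {n : ℕ} {A : Finset (Fin n → ℝ)} (hA : IsLatticeConvex A)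
    {p u : Fin n → ℝ} {N t : ℕ} (hp : p ∈ A) (hq : p + (N : ℝ) • u ∈ A) (hu : u ∈ intLattice n)
    (ht : t ≤ N) : p + (t : ℝ) • u ∈ A := by
  rcases Nat.eq_zero_or_pos N with rfl | hN
  · obtain rfl : t = 0 := by omega
    exact hq
  refine (hA _).2 ⟨?_, Submodule.add_mem _ ((hA _).1 hp).2 ?_⟩
  · have hN' : (0 : ℝ) < N := by exact_mod_cast hN
    have ht' : (t : ℝ) ≤ N := by exact_mod_cast ht
    have h := (convex_convexHull ℝ (A : Set (Fin n → ℝ))).add_smul_sub_mem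
      ((hA _).1 hp).1 ((hA _).1 hq).1 (t := (t : ℝ) / N)
      ⟨by positivity, by rw [div_le_one hN']; exact ht'⟩
    convert h using 2
    rw [add_sub_cancel_left, smul_smul, div_mul_cancel₀ _ hN'.ne']
  · convert Submodule.smul_mem (intLattice n) (t : ℤ) hu using 1
    ext j
    simp

/-- The segment carries `N + 1` distinct lattice points. Every length bound below comes from this
count. -/
theorem IsLatticeConvex.lt_card {n : ℕ} {A : Finset (Fin n → ℝ)} (hA : IsLatticeConvex A)
    {p u : Fin n → ℝ} {N : ℕ} (hp : p ∈ A) (hq : p + (N : ℝ) • u ∈ A) (hu : u ∈ intLattice n)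
    (hu0 : u ≠ 0) : N < A.card := by
  have h : ((range (N + 1)).image fun t : ℕ => p + (t : ℝ) • u) ⊆ A := by
    intro x hx
    obtain ⟨t, ht, rfl⟩ := mem_image.1 hx
    exact hA.segment_mem hp hq hu (by simpa [Nat.lt_succ_iff] using ht)
  have h2 := card_le_card h
  rw [card_image_of_injective, card_range] at h2
  · omega
  · intro s t hst
    have h3 : (s : ℝ) • u = (t : ℝ) • u := add_left_cancel hst
    exact_mod_cast smul_left_injective ℝ hu0 h3

theorem VertexFrame.edge_ne_zero {n : ℕ} {A : Finset (Fin n → ℝ)} {V : Submodule ℝ (Fin n → ℝ)}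
    {d : ℕ} {v : Fin n → ℝ} (F : VertexFrame A V d v) (i : Fin d) : F.edge i ≠ 0 := by
  intro h
  have := F.coord_edge i i
  simp [h] at this

/-- Adding a large multiple of `φ` makes a functional positive wherever `φ` is, on a finite set. -/
theorem exists_add_mul_pos {α : Type*} (A : Finset α) (φ θ : α → ℝ) :
    ∃ K : ℝ, 0 < K ∧ ∀ a ∈ A, 0 < φ a → 0 < θ a + K * φ a := by
  classical
  induction A using Finset.induction_on with
  | empty => exact ⟨1, one_pos, by simp⟩
  | insert x A _ ih =>
    obtain ⟨K, hK, h⟩ := ih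
    refine ⟨max K ((|θ x| + 1) / φ x), lt_max_of_lt_left hK, fun a ha hpos => ?_⟩
    rcases mem_insert.1 ha with rfl | ha
    · have h1 : (|θ a| + 1) ≤ max K ((|θ a| + 1) / φ a) * φ a := by
        rw [← div_le_iff₀ hpos]; exact le_max_right _ _
      linarith [neg_abs_le (θ a)]
    · have h1 : K * φ a ≤ max K ((|θ x| + 1) / φ x) * φ a :=
        mul_le_mul_of_nonneg_right (le_max_left _ _) hpos.le
      linarith [h a ha hpos]

/-- A point `v` of `A` farthest from the origin works, with the inner product with `-v` as
functional. -/
theorem exists_isVertex {n : ℕ} {A : Finset (Fin n → ℝ)} (hA : A.Nonempty) :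
    ∃ v, IsVertex A v := by
  obtain ⟨v, hv, hmax⟩ := exists_max_image A (fun x => ∑ i, x i ^ 2) hA
  refine ⟨v, hv, ∑ i, (-v i) • LinearMap.proj i, fun a ha hne => ?_⟩
  have h1 : 0 < ∑ i, (a i - v i) ^ 2 := by
    obtain ⟨i, hi⟩ := Function.ne_iff.1 hne
    exact sum_pos' (fun i _ => sq_nonneg _) ⟨i, mem_univ _, by
      have := sub_ne_zero.2 hi; positivity⟩
  have h2 := hmax a ha
  have h3 : ∑ i, (a i - v i) ^ 2
      = ∑ i, a i ^ 2 - ∑ i, v i ^ 2 + 2 * ∑ i, (-v i) * (a i - v i) := by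
    rw [mul_sum, ← sum_sub_distrib, ← sum_add_distrib]
    exact sum_congr rfl fun i _ => by ring
  simp only [LinearMap.sum_apply, LinearMap.smul_apply, LinearMap.proj_apply, Pi.sub_apply,
    smul_eq_mul]
  linarith

/-! ### The far end of an edge -/

section Frame

variable {n : ℕ} {A : Finset (Fin n → ℝ)} {V : Submodule ℝ (Fin n → ℝ)} {d : ℕ}
  {v : Fin n → ℝ}

/-- The sum of all coordinates but the `i`-th. -/
def VertexFrame.offEdge (F : VertexFrame A V d v) (i : Fin d) : (Fin n → ℝ) →ₗ[ℝ] ℝ :=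
  ∑ j ∈ univ.erase i, F.coord j

theorem VertexFrame.offEdge_apply (F : VertexFrame A V d v) (i : Fin d) (x : Fin n → ℝ) :
    F.offEdge i x = ∑ j ∈ univ.erase i, F.coord j x := by
  simp [VertexFrame.offEdge]

/-- The coordinates are nonnegative on `A - v`, so if the sum of those off `i` is not positive, each
of them vanishes. -/
theorem VertexFrame.exists_smul_edge_of_offEdge (F : VertexFrame A V d v) {i : Fin d}
    {a : Fin n → ℝ} (ha : a ∈ A) (haV : a - v ∈ V) (h : ¬ 0 < F.offEdge i (a - v)) :
    a - v = F.coord i (a - v) • F.edge i := by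
  have h1 : ∀ j ∈ univ.erase i, 0 ≤ F.coord j (a - v) := fun j _ => F.coord_nonneg a ha j
  have h2 : ∑ j ∈ univ.erase i, F.coord j (a - v) = 0 :=
    le_antisymm (by rw [← F.offEdge_apply]; exact not_lt.1 h) (sum_nonneg h1)
  have h3 := (sum_eq_zero_iff_of_nonneg h1).1 h2
  conv_lhs => rw [F.eq_sum _ haV]
  rw [← add_sum_erase _ _ (mem_univ i), sum_eq_zero, add_zero]
  intro j hj
  rw [h3 j hj, zero_smul]

/-- The other end of the edge in direction `F.edge i` is again a vertex. -/
theorem VertexFrame.exists_neighbour (F : VertexFrame A V d v) (hA : IsLatticeConvex A)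
    (hv : v ∈ A) (hV : ∀ a ∈ A, a - v ∈ V) (i : Fin d) :
    ∃ l : ℕ, 0 < l ∧ IsVertex A (v + (l : ℝ) • F.edge i) := by
  classical
  -- The filter keeps the points of `A` on the ray from `v` along `F.edge i`; `w` is the last of
  -- them.
  obtain ⟨w, hw, hmax⟩ := exists_max_image (A.filter fun a => ¬ 0 < F.offEdge i (a - v))
    (fun a => F.coord i (a - v)) ⟨v, by simp [hv]⟩
  rw [mem_filter] at hw
  have hwv := F.exists_smul_edge_of_offEdge hw.1 (hV w hw.1) hw.2
  have hge : 1 ≤ F.coord i (w - v) := by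
    have h := hmax (v + F.edge i) (mem_filter.2 ⟨F.add_edge_mem i, by
      rw [F.offEdge_apply, add_sub_cancel_left, sum_eq_zero]
      · exact lt_irrefl _
      · intro j hj
        rw [F.coord_edge, if_neg (ne_of_mem_erase hj)]⟩)
    simpa [F.coord_edge] using h
  obtain ⟨c, hc⟩ := F.coord_int (w - v) (hV w hw.1)
    (intLattice_sub_mem ((hA _).1 hw.1).2 ((hA _).1 hv).2) i
  have hc1 : 1 ≤ c := by rw [hc] at hge; exact_mod_cast hge
  lift c to ℕ using by omega
  have hwe : v + (c : ℝ) • F.edge i = w := by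
    have : ((c : ℤ) : ℝ) = (c : ℝ) := by norm_cast
    rw [← this, ← hc, ← hwv]; abel
  refine ⟨c, by omega, ?_⟩
  rw [hwe]
  -- The functional `K • F.offEdge i - F.coord i` is minimal exactly at `w`: off the ray the penalty
  -- `K` dominates, on the ray the coordinate decides.
  obtain ⟨K, hK, hpos⟩ := exists_add_mul_pos A (fun a => F.offEdge i (a - v))
    (fun a => -F.coord i (a - w))
  have hoffw : F.offEdge i (w - v) = 0 := by
    rw [hwv, map_smul, F.offEdge_apply, sum_eq_zero, smul_zero]
    intro j hj
    rw [F.coord_edge, if_neg (ne_of_mem_erase hj)]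
  refine ⟨hw.1, K • F.offEdge i - F.coord i, fun a ha hne => ?_⟩
  have hoff : F.offEdge i (a - w) = F.offEdge i (a - v) := by
    have : a - w = (a - v) - (w - v) := by abel
    rw [this, map_sub, hoffw, sub_zero]
  rw [LinearMap.sub_apply, LinearMap.smul_apply, smul_eq_mul, hoff]
  by_cases h0 : 0 < F.offEdge i (a - v)
  · linarith [hpos a ha h0]
  · have h1 := hmax a (mem_filter.2 ⟨ha, h0⟩)
    have h2 := F.exists_smul_edge_of_offEdge ha (hV a ha) h0
    have h3 : F.offEdge i (a - v) = 0 := by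
      rw [h2, map_smul, F.offEdge_apply, sum_eq_zero, smul_zero]
      intro j hj
      rw [F.coord_edge, if_neg (ne_of_mem_erase hj)]
    have h4 : F.coord i (a - v) ≠ F.coord i (w - v) := by
      intro h
      rw [h, ← hwv] at h2
      exact hne (sub_left_injective h2)
    have h5 : F.coord i (a - w) = F.coord i (a - v) - F.coord i (w - v) := by
      rw [← map_sub]; congr 1; abel
    have h6 := lt_of_le_of_ne h1 h4
    rw [h3, h5]
    linarith

end Frame

/-! ### Comparison of the frames at the two ends of an edge -/

section Frame

variable {n : ℕ} {A : Finset (Fin n → ℝ)} {V : Submodule ℝ (Fin n → ℝ)} {d : ℕ}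
  {v : Fin n → ℝ}

theorem one_le_of_int_of_pos {x : ℝ} (h : ∃ c : ℤ, x = c) (hx : 0 < x) : 1 ≤ x := by
  obtain ⟨c, rfl⟩ := h
  have : 0 < c := by exact_mod_cast hx
  exact_mod_cast this

theorem VertexFrame.coord_edge_int {w : Fin n → ℝ} (F : VertexFrame A V d v)
    (F' : VertexFrame A V d w) (i j : Fin d) : ∃ c : ℤ, F.coord i (F'.edge j) = c :=
  F.coord_int _ (F'.edge_mem_span j) (F'.edge_mem j) i

theorem VertexFrame.apply_eq_sum (F : VertexFrame A V d v) (φ : (Fin n → ℝ) →ₗ[ℝ] ℝ)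
    {x : Fin n → ℝ} (hx : x ∈ V) : φ x = ∑ i, F.coord i x * φ (F.edge i) := by
  conv_lhs => rw [F.eq_sum x hx]
  simp

variable {i : Fin d} {l : ℕ} (F : VertexFrame A V d v)
  (F' : VertexFrame A V d (v + (l : ℝ) • F.edge i))

-- The point `w + F'.edge j` of `A` lies in the orthant at `v`, and `w` differs from `v` by `l` in
-- coordinate `i` only.
include F' in
theorem VertexFrame.coord_neighbour_edge_add_nonneg (j m : Fin d) :
    0 ≤ F.coord m (F'.edge j) + if m = i then (l : ℝ) else 0 := by
  have h := F.coord_nonneg _ (F'.add_edge_mem j) m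
  have h2 : v + (l : ℝ) • F.edge i + F'.edge j - v = (l : ℝ) • F.edge i + F'.edge j := by abel
  rw [h2, map_add, map_smul, F.coord_edge] at h
  split_ifs at h ⊢ <;> simp at h ⊢ <;> linarith

include F' in
theorem VertexFrame.coord_neighbour_edge_nonneg (j : Fin d) {m : Fin d} (hm : m ≠ i) :
    0 ≤ F.coord m (F'.edge j) := by
  simpa [hm] using F.coord_neighbour_edge_add_nonneg F' j m

include F' in
/-- One of the edge directions at the other end of an edge is the reversed edge. -/
theorem VertexFrame.exists_neighbour_edge_eq_neg (hv : v ∈ A) (hl : 0 < l) :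
    ∃ j, F'.edge j = -F.edge i := by
  have hl' : (0 : ℝ) < l := by exact_mod_cast hl
  -- Here `v - w = -l • F.edge i` lies in the orthant of `F'`.
  have hd : ∀ j, F'.coord j (F.edge i) ≤ 0 := by
    intro j
    have h := F'.coord_nonneg v hv j
    rw [sub_add_cancel_left, map_neg, map_smul, smul_eq_mul] at h
    nlinarith
  obtain ⟨j, hj⟩ : ∃ j, F'.coord j (F.edge i) ≠ 0 := by
    by_contra! h
    apply F.edge_ne_zero i
    rw [F'.eq_sum _ (F.edge_mem_span i)]
    exact sum_eq_zero fun j _ => by rw [h j, zero_smul]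
  have hneg : F'.coord j (F.edge i) < 0 := lt_of_le_of_ne (hd j) hj
  -- Expanding `F.coord m (F.edge i) = 0` in the frame `F'` gives a sum of nonpositive terms, so
  -- each one is zero.
  have hzero : ∀ m, m ≠ i → F.coord m (F'.edge j) = 0 := by
    intro m hm
    have h1 := F'.apply_eq_sum (F.coord m) (F.edge_mem_span i)
    rw [F.coord_edge, if_neg hm] at h1
    have h2 := (sum_eq_zero_iff_of_nonpos fun j _ =>
      mul_nonpos_of_nonpos_of_nonneg (hd j) (F.coord_neighbour_edge_nonneg F' j hm)).1 h1.symm j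
      (mem_univ j)
    exact (mul_eq_zero.1 h2).resolve_left hj
  have hmul : F'.edge j = F.coord i (F'.edge j) • F.edge i := by
    conv_lhs => rw [F.eq_sum _ (F'.edge_mem_span j)]
    rw [sum_eq_single i]
    · intro m _ hm
      rw [hzero m hm, zero_smul]
    · simp
  have hone := F'.coord_edge j j
  rw [hmul, map_smul, smul_eq_mul, if_pos rfl] at hone
  obtain ⟨c, hc⟩ := F.coord_edge_int F' i j
  obtain ⟨e, he⟩ := F'.coord_edge_int F j i
  rw [hc, he] at hone
  rw [he] at hneg
  have hone' : c * e = 1 := by exact_mod_cast hone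
  have hneg' : e < 0 := by exact_mod_cast hneg
  have hc1 : c = -1 := by
    rcases Int.mul_eq_one_iff_eq_one_or_neg_one.1 hone' with h | h <;> omega
  refine ⟨j, ?_⟩
  rw [hmul, hc, hc1]
  simp

include F' in
/-- Edge directions at the two ends of an edge agree modulo that edge. -/
theorem VertexFrame.neighbour_edge_eq (hv : v ∈ A) (hl : 0 < l) (j : Fin d)
    (hj : F'.edge j ≠ -F.edge i) :
    ∃ m, m ≠ i ∧ F'.edge j = F.edge m + F.coord i (F'.edge j) • F.edge i := by
  obtain ⟨j₀, hj₀⟩ := F.exists_neighbour_edge_eq_neg F' hv hl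
  have hjj : ∀ j, F'.edge j ≠ -F.edge i → j ≠ j₀ := by
    rintro j h rfl
    exact h hj₀
  have hi : ∀ j, j ≠ j₀ → F'.coord j (F.edge i) = 0 := by
    intro j h
    have h1 := F'.coord_edge j j₀
    rw [hj₀, map_neg, if_neg h, neg_eq_zero] at h1
    exact h1
  have hd : ∀ j, j ≠ j₀ → ∀ m, 0 ≤ F'.coord j (F.edge m) := by
    intro j h m
    have h1 := F'.coord_nonneg _ (F.add_edge_mem m) j
    rw [add_sub_add_left_eq_sub, map_sub, map_smul, hi j h] at h1
    simpa using h1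
  have hjne := hjj j hj
  -- Some term is nonzero in the expansion of `F'.coord j (F'.edge j) = 1` in the frame `F`.
  obtain ⟨m, -, hm⟩ : ∃ m ∈ univ, F.coord m (F'.edge j) * F'.coord j (F.edge m) ≠ 0 := by
    apply exists_ne_zero_of_sum_ne_zero
    rw [← F.apply_eq_sum (F'.coord j) (F'.edge_mem_span j), F'.coord_edge, if_pos rfl]
    exact one_ne_zero
  have hmi : m ≠ i := by
    rintro rfl
    rw [hi j hjne, mul_zero] at hm
    exact hm rfl
  have hcm : 1 ≤ F.coord m (F'.edge j) := one_le_of_int_of_pos (F.coord_edge_int F' m j)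
    (lt_of_le_of_ne (F.coord_neighbour_edge_nonneg F' j hmi) (left_ne_zero_of_mul hm).symm)
  have hdm : 1 ≤ F'.coord j (F.edge m) := one_le_of_int_of_pos (F'.coord_edge_int F j m)
    (lt_of_le_of_ne (hd j hjne m) (right_ne_zero_of_mul hm).symm)
  -- Expand `F.coord m' (F.edge m)` in the frame `F'`: the `j₀` term vanishes, the others are
  -- nonnegative, and the `j` term is at least `F.coord m' (F'.edge j)` by `hdm`.
  have hle : ∀ m', m' ≠ i → F.coord m' (F'.edge j) ≤ if m' = m then 1 else 0 := by
    intro m' hm'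
    have h1 := F'.apply_eq_sum (F.coord m') (F.edge_mem_span m)
    rw [F.coord_edge] at h1
    rw [h1]
    have hnn := F.coord_neighbour_edge_nonneg F' j hm'
    calc F.coord m' (F'.edge j) ≤ F'.coord j (F.edge m) * F.coord m' (F'.edge j) := by
          nlinarith
      _ ≤ _ := by
          refine single_le_sum (f := fun j => F'.coord j (F.edge m) * F.coord m' (F'.edge j))
            (fun j' _ => ?_) (mem_univ j)
          by_cases h : j' = j₀
          · rw [h, hj₀, map_neg, F.coord_edge, if_neg hm']
            simp
          · exact mul_nonneg (hd j' h m) (F.coord_neighbour_edge_nonneg F' j' hm')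
  have heq : ∀ m', m' ≠ i → F.coord m' (F'.edge j) = if m' = m then 1 else 0 := by
    intro m' hm'
    have h1 := hle m' hm'
    have h2 := F.coord_neighbour_edge_nonneg F' j hm'
    split_ifs at h1 ⊢ with h
    · subst h
      exact le_antisymm h1 hcm
    · exact le_antisymm h1 h2
  refine ⟨m, hmi, ?_⟩
  conv_lhs => rw [F.eq_sum _ (F'.edge_mem_span j)]
  rw [← sum_erase_add _ _ (mem_univ i)]
  congr 1
  rw [sum_eq_single m]
  · rw [heq m hmi, if_pos rfl, one_smul]
  · intro m' h1 h2
    rw [heq m' (ne_of_mem_erase h1), if_neg h2, zero_smul]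
  · intro h
    exact absurd (mem_erase.2 ⟨hmi, mem_univ m⟩) h

theorem VertexFrame.length_lt_card (hA : IsLatticeConvex A) (hv : v ∈ A)
    (hw : v + (l : ℝ) • F.edge i ∈ A) : l < A.card :=
  hA.lt_card hv hw (F.edge_mem i) (F.edge_ne_zero i)

include F' in
theorem VertexFrame.abs_coord_neighbour_edge_le (hA : IsLatticeConvex A) (hv : v ∈ A) (hl : 0 < l)
    (hw : v + (l : ℝ) • F.edge i ∈ A) (j m : Fin d) :
    |F.coord m (F'.edge j)| ≤ A.card := by
  have hcard : (1 : ℝ) ≤ A.card := by exact_mod_cast card_pos.2 ⟨v, hv⟩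
  by_cases hj : F'.edge j = -F.edge i
  · rw [hj, map_neg, F.coord_edge]
    split_ifs
    · rwa [abs_neg, abs_one]
    · rw [neg_zero, abs_zero]; linarith
  obtain ⟨m₀, hm₀, h⟩ := F.neighbour_edge_eq F' hv hl j hj
  have hlow := F.coord_neighbour_edge_add_nonneg F' j i
  rw [if_pos rfl] at hlow
  have hlen : (l : ℝ) < A.card := by exact_mod_cast F.length_lt_card hA hv hw
  obtain ⟨c, hc⟩ := F.coord_edge_int F' i j
  by_cases hm : m = i
  · subst hm
    rw [hc] at hlow h ⊢
    have hN : 0 ≤ c + l := by exact_mod_cast hlow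
    obtain ⟨N, hN⟩ := Int.eq_ofNat_of_zero_le hN
    have hNr : (c : ℝ) + l = N := by exact_mod_cast hN
    have hq := F'.add_edge_mem j
    -- The segment in direction `F.edge m` joins `v + F.edge m₀` to `w + F'.edge j`; its length is
    -- `N = c + l`.
    have hlt := hA.lt_card (N := N) (u := F.edge m) (F.add_edge_mem m₀)
      (by convert hq using 1
          rw [h, ← hNr, add_smul]
          abel) (F.edge_mem m) (F.edge_ne_zero m)
    have hlt' : (N : ℝ) < A.card := by exact_mod_cast hlt
    have hl0 : (0 : ℝ) ≤ l := Nat.cast_nonneg l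
    rw [abs_le]
    constructor <;> linarith
  · rw [h, map_add, map_smul, F.coord_edge, F.coord_edge, if_neg hm]
    split_ifs
    · rwa [smul_zero, add_zero, abs_one]
    · rw [smul_zero, add_zero, abs_zero]; linarith

end Frame

/-! ### The simplex method -/

/-- The bound for coordinates produced by `m` steps of the simplex method. -/
def coordBound (d k : ℕ) : ℕ → ℝ → ℝ
  | 0, _ => 0
  | m + 1, C => k * C + coordBound d k m (d * k * C)

theorem coordBound_nonneg (d k m : ℕ) {C : ℝ} (hC : 0 ≤ C) : 0 ≤ coordBound d k m C := by
  induction m generalizing C with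
  | zero => exact le_rfl
  | succ m ih => exact add_nonneg (by positivity) (ih (by positivity))

/-- Induction on the number of points of `A` above `φ v`. If `φ (a - v)` is positive, then `φ` is
positive on some edge at `v`, because `a - v` is a nonnegative combination of edges; move to the far
end of that edge. -/
theorem VertexFrame.apply_sub_le {n : ℕ} {A : Finset (Fin n → ℝ)}
    {V : Submodule ℝ (Fin n → ℝ)} {d : ℕ} (hA : IsLatticeConvex A)
    (hV : ∀ a ∈ A, ∀ b ∈ A, a - b ∈ V)
    (hF : ∀ v, IsVertex A v → Nonempty (VertexFrame A V d v)) (m : ℕ) (C : ℝ) (hC : 0 ≤ C)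
    (φ : (Fin n → ℝ) →ₗ[ℝ] ℝ) {v : Fin n → ℝ} (hv : v ∈ A) (F : VertexFrame A V d v)
    (hφ : ∀ i, |φ (F.edge i)| ≤ C) (hm : (A.filter fun a => φ v < φ a).card ≤ m)
    {a : Fin n → ℝ} (ha : a ∈ A) : φ (a - v) ≤ coordBound d A.card m C := by
  classical
  induction m generalizing C v with
  | zero =>
    have h1 : a ∉ A.filter fun a => φ v < φ a := by
      rw [card_eq_zero.1 (Nat.le_zero.1 hm)]
      simp
    have h2 : φ a ≤ φ v := by simpa [ha] using h1
    rw [map_sub]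
    simpa [coordBound] using h2
  | succ m ih =>
    by_cases hav : φ (a - v) ≤ 0
    · exact hav.trans (coordBound_nonneg _ _ _ hC)
    obtain ⟨i, hi⟩ : ∃ i, 0 < φ (F.edge i) := by
      by_contra! h
      apply hav
      rw [F.apply_eq_sum φ (hV a ha v hv)]
      exact sum_nonpos fun i _ => mul_nonpos_of_nonneg_of_nonpos (F.coord_nonneg a ha i) (h i)
    obtain ⟨l, hl, hw⟩ := F.exists_neighbour hA hv (fun a ha => hV a ha v hv) i
    obtain ⟨F'⟩ := hF _ hw
    have hl' : (0 : ℝ) < l := by exact_mod_cast hl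
    have hφw : φ (v + (l : ℝ) • F.edge i) = φ v + l * φ (F.edge i) := by simp
    have hφv : φ v < φ (v + (l : ℝ) • F.edge i) := by
      rw [hφw]
      have := mul_pos hl' hi
      linarith
    have h1 := ih (d * A.card * C) (by positivity) hw.1 F' (fun j => ?_) ?_
    · have h2 : φ (a - v) = l * φ (F.edge i) + φ (a - (v + (l : ℝ) • F.edge i)) := by
        rw [map_sub, map_sub, hφw]
        ring
      have h3 : (l : ℝ) ≤ A.card := by exact_mod_cast (F.length_lt_card hA hv hw.1).le
      have h4 : (l : ℝ) * φ (F.edge i) ≤ A.card * C :=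
        mul_le_mul h3 ((le_abs_self _).trans (hφ i)) hi.le (Nat.cast_nonneg _)
      rw [h2, coordBound]
      linarith
    · rw [F.apply_eq_sum φ (F'.edge_mem_span j)]
      refine (abs_sum_le_sum_abs _ _).trans ?_
      calc ∑ m, |F.coord m (F'.edge j) * φ (F.edge m)| ≤ ∑ _m : Fin d, A.card * C := by
            refine sum_le_sum fun m _ => ?_
            rw [abs_mul]
            exact mul_le_mul (F.abs_coord_neighbour_edge_le F' hA hv hl hw.1 j m) (hφ m)
              (abs_nonneg _) (Nat.cast_nonneg _)
        _ = _ := by simp [mul_assoc]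
    -- The new vertex lies above `φ v` but not above its own value, so the inclusion is strict.
    · have hss : (A.filter fun a => φ (v + (l : ℝ) • F.edge i) < φ a)
          ⊂ A.filter fun a => φ v < φ a := by
        refine (ssubset_iff_of_subset fun x hx => ?_).2
          ⟨v + (l : ℝ) • F.edge i, mem_filter.2 ⟨hw.1, hφv⟩, by simp⟩
        rw [mem_filter] at hx ⊢
        exact ⟨hx.1, hφv.trans hx.2⟩
      have := card_lt_card hss
      omega

theorem VertexFrame.coord_le {n : ℕ} {A : Finset (Fin n → ℝ)}
    {V : Submodule ℝ (Fin n → ℝ)} {d : ℕ} (hA : IsLatticeConvex A)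
    (hV : ∀ a ∈ A, ∀ b ∈ A, a - b ∈ V)
    (hF : ∀ v, IsVertex A v → Nonempty (VertexFrame A V d v)) {v : Fin n → ℝ} (hv : v ∈ A)
    (F : VertexFrame A V d v) {a : Fin n → ℝ} (ha : a ∈ A) (i : Fin d) :
    F.coord i (a - v) ≤ coordBound d A.card A.card 1 :=
  F.apply_sub_le hA hV hF A.card 1 zero_le_one (F.coord i) hv
    (fun j => by rw [F.coord_edge]; split_ifs <;> simp) (card_filter_le _ _) ha

/-! ### From unimodular normal cones to frames -/

theorem intLattice_eq_span (n : ℕ) :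
    intLattice n = Submodule.span ℤ (Set.range (Pi.basisFun ℝ (Fin n))) := by
  ext x
  rw [Module.Basis.mem_span_iff_repr_mem ℤ (Pi.basisFun ℝ (Fin n))]
  simp only [Pi.basisFun_repr, Set.mem_range, algebraMap_int_eq, eq_intCast]
  exact forall_congr' fun i => exists_congr fun k => eq_comm

instance (n : ℕ) : DiscreteTopology (intLattice n) := by
  rw [intLattice_eq_span]
  infer_instance

/-- By `hspan`, the lattice `M` has a `ℤ`-basis `e` that is a real basis of `V`, and the dual
lattice is the `ℤ`-span of its dual basis. So `b` is a real basis of the dual space. The basis `u`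
dual to `b` is integral because its `e`-coordinates are `b`-coordinates of elements of the dual
lattice. -/
theorem exists_dual_edges {n : ℕ} {P : Set (Fin n → ℝ)}
    (hspan : Submodule.span ℝ {x : vectorSpan ℝ P | (x : Fin n → ℝ) ∈ intLattice n} = ⊤)
    {m : ℕ} (b : Module.Basis (Fin m) ℤ (dualLattice P)) :
    ∃ u : Module.Basis (Fin m) ℝ (vectorSpan ℝ P),
      (∀ i j, (b i : Module.Dual ℝ (vectorSpan ℝ P)) (u j) = if i = j then 1 else 0) ∧
      ∀ j, (u j : Fin n → ℝ) ∈ intLattice n := by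
  classical
  let V := vectorSpan ℝ P
  let M : Submodule ℤ V := ZLattice.comap ℝ (intLattice n) V.subtype
  have hdisc : DiscreteTopology M :=
    ZLattice.comap_discreteTopology ℝ (intLattice n) (e := V.subtype)
      continuous_subtype_val Subtype.val_injective
  have hlat : IsZLattice ℝ M := ⟨hspan⟩
  have := ZLattice.module_finite ℝ M
  have := ZLattice.module_free ℝ M
  let e₀ := Module.Free.chooseBasis ℤ M
  let e : Module.Basis _ ℝ V := e₀.ofZLatticeBasis ℝ M
  have he : ∀ i, e i = (e₀ i : V) := fun i => e₀.ofZLatticeBasis_apply ℝ M i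
  have hint : ∀ φ ∈ dualLattice P, ∀ i, ∃ c : ℤ, φ (e i) = c := fun φ hφ i =>
    hφ (e i) (by rw [he]; exact (e₀ i).2)
  have hdual : dualLattice P = Submodule.span ℤ (Set.range e.dualBasis) := by
    ext φ
    rw [Module.Basis.mem_span_iff_repr_mem ℤ e.dualBasis]
    simp only [e.dualBasis_repr]
    constructor
    · intro hφ i
      obtain ⟨c, hc⟩ := hint φ hφ i
      exact ⟨c, by simp [hc]⟩
    · intro h v hv
      choose c hc using h
      have hv' : v ∈ M := hv
      have h1 : ∀ i, e.repr v i = (e₀.repr ⟨v, hv'⟩ i : ℤ) := fun i =>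
        e₀.ofZLatticeBasis_repr_apply ℝ M ⟨v, hv'⟩ i
      refine ⟨∑ i, e₀.repr ⟨v, hv'⟩ i * c i, ?_⟩
      conv_lhs => rw [← e.sum_repr v]
      simp only [map_sum, map_smul, h1, ← hc]
      simp
  have hcard : Fintype.card (Fin m) = Module.finrank ℝ (Module.Dual ℝ V) := by
    have hb : Module.finrank ℤ (dualLattice P) = m := by
      rw [Module.finrank_eq_card_basis b, Fintype.card_fin]
    have hli : LinearIndependent ℤ e.dualBasis :=
      e.dualBasis.linearIndependent.restrict_scalars' ℤ
    rw [hdual, finrank_span_eq_card hli] at hb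
    rw [Module.finrank_eq_card_basis e.dualBasis, hb, Fintype.card_fin]
  have hspanb : ⊤ ≤ Submodule.span ℝ
      (Set.range fun i => (b i : Module.Dual ℝ V)) := by
    rw [← e.dualBasis.span_eq, Submodule.span_le]
    rintro _ ⟨j, rfl⟩
    have hj : e.dualBasis j ∈ dualLattice P := by
      rw [hdual]; exact Submodule.subset_span ⟨j, rfl⟩
    have h1 := congrArg (Subtype.val) (b.sum_repr ⟨_, hj⟩)
    simp only [Submodule.coe_sum, Submodule.coe_smul] at h1
    rw [← h1]
    refine Submodule.sum_mem _ fun i _ => ?_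
    rw [← Int.cast_smul_eq_zsmul ℝ]
    exact Submodule.smul_mem _ _ (Submodule.subset_span ⟨i, rfl⟩)
  let B : Module.Basis (Fin m) ℝ (Module.Dual ℝ V) :=
    basisOfTopLeSpanOfCardEqFinrank _ hspanb hcard
  have hB : ∀ i, B i = (b i : Module.Dual ℝ V) := fun i => by
    simp [B]
  let u : Module.Basis (Fin m) ℝ V := B.dualBasis.map (Module.evalEquiv ℝ V).symm
  have hu : ∀ (φ : Module.Dual ℝ V) j, φ (u j) = B.repr φ j := by
    intro φ j
    have h : φ (u j) = Module.evalEquiv ℝ V (u j) φ := rfl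
    rw [h]
    simp [u, Module.Basis.coord]
  refine ⟨u, fun i j => ?_, fun j => ?_⟩
  · rw [hu, ← hB, B.repr_self, Finsupp.single_apply]
  · have h1 : ∀ l, ∃ c : ℤ, e.repr (u j) l = c := by
      intro l
      have hl : e.dualBasis l ∈ dualLattice P := by
        rw [hdual]; exact Submodule.subset_span ⟨l, rfl⟩
      refine ⟨b.repr ⟨_, hl⟩ j, ?_⟩
      have h2 := congrArg (Subtype.val) (b.sum_repr ⟨_, hl⟩)
      simp only [Submodule.coe_sum, Submodule.coe_smul] at h2
      have h3 : e.repr (u j) l = e.dualBasis l (u j) := by simp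
      refine h3.trans ((LinearMap.congr_fun h2 (u j)).symm.trans ?_)
      simp only [hu, ← hB]
      simp [Finsupp.single_apply]
    choose c hc using h1
    have hmem : u j ∈ M := by
      rw [← e.sum_repr (u j)]
      refine Submodule.sum_mem _ fun l _ => ?_
      rw [hc, Int.cast_smul_eq_zsmul, he]
      exact Submodule.smul_mem _ _ (e₀ l).2
    exact hmem

theorem vectorSpan_convexHull_eq {n : ℕ} (A : Set (Fin n → ℝ)) :
    vectorSpan ℝ (convexHull ℝ A) = vectorSpan ℝ A := by
  rw [← direction_affineSpan, affineSpan_convexHull, direction_affineSpan]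

theorem sub_mem_vectorSpan_convexHull {n : ℕ} {A : Finset (Fin n → ℝ)} {a b : Fin n → ℝ}
    (ha : a ∈ A) (hb : b ∈ A) : a - b ∈ vectorSpan ℝ (convexHull ℝ (A : Set (Fin n → ℝ))) :=
  vsub_mem_vectorSpan ℝ (subset_convexHull ℝ _ ha) (subset_convexHull ℝ _ hb)

theorem IsLatticeConvex.span_lattice_eq_top {n : ℕ} {A : Finset (Fin n → ℝ)}
    (hA : IsLatticeConvex A) :
    Submodule.span ℝ {x : vectorSpan ℝ (convexHull ℝ (A : Set (Fin n → ℝ))) |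
      (x : Fin n → ℝ) ∈ intLattice n} = ⊤ := by
  set V := vectorSpan ℝ (convexHull ℝ (A : Set (Fin n → ℝ)))
  have h : V ≤ (Submodule.span ℝ {x : V | (x : Fin n → ℝ) ∈ intLattice n}).map V.subtype := by
    refine (vectorSpan_convexHull_eq (A : Set (Fin n → ℝ))).le.trans (Submodule.span_le.2 ?_)
    rintro _ ⟨a, ha, b, hb, rfl⟩
    exact ⟨⟨a - b, sub_mem_vectorSpan_convexHull ha hb⟩, Submodule.subset_span
      (intLattice_sub_mem ((hA _).1 ha).2 ((hA _).1 hb).2), rfl⟩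
  rw [eq_top_iff]
  rintro x -
  obtain ⟨y, hy, hyx⟩ := h x.2
  rwa [← Subtype.ext hyx]

theorem IsVertex.isExposed_singleton {n : ℕ} {A : Finset (Fin n → ℝ)} {v : Fin n → ℝ}
    (hv : IsVertex A v) : IsExposed ℝ (convexHull ℝ (A : Set (Fin n → ℝ))) {v} := by
  obtain ⟨hvA, φ, hφ⟩ := hv
  have hP : ∀ x ∈ convexHull ℝ (A : Set (Fin n → ℝ)), x = v ∨ φ v < φ x := by
    -- An open half-space together with one boundary point is convex.
    have hconv : Convex ℝ {x | x = v ∨ φ v < φ x} := by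
      have h0 : ∀ x, (x = v ∨ φ v < φ x) → φ v ≤ φ x := by
        rintro x (rfl | h)
        exacts [le_rfl, h.le]
      intro x hx y hy a b ha hb hab
      simp only [Set.mem_ofPred_eq, map_add, map_smul, smul_eq_mul] at hx hy ⊢
      have hvv : φ v = a * φ v + b * φ v := by rw [← add_mul, hab, one_mul]
      have hx' := mul_le_mul_of_nonneg_left (h0 x hx) ha
      have hy' := mul_le_mul_of_nonneg_left (h0 y hy) hb
      rcases ha.eq_or_lt with rfl | ha
      · obtain rfl : b = 1 := by linarith
        simpa using hy
      rcases hb.eq_or_lt with rfl | hb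
      · obtain rfl : a = 1 := by linarith
        simpa using hx
      rcases hx with rfl | hx
      · rcases hy with rfl | hy
        · left
          rw [← add_smul, hab, one_smul]
        · right
          have := mul_lt_mul_of_pos_left hy hb
          linarith
      · right
        have := mul_lt_mul_of_pos_left hx ha
        linarith
    refine fun x hx => convexHull_min (fun a ha => ?_) hconv hx
    by_cases h : a = v
    · exact Or.inl h
    · have := hφ a ha h
      rw [map_sub] at this
      exact Or.inr (by linarith)
  intro _
  -- `IsExposed` asks for a maximum, hence the sign.
  refine ⟨LinearMap.toContinuousLinearMap (-φ), ?_⟩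
  have hvP : v ∈ convexHull ℝ (A : Set (Fin n → ℝ)) := subset_convexHull ℝ _ hvA
  ext x
  simp only [Set.mem_singleton_iff, Set.mem_ofPred_eq, LinearMap.coe_toContinuousLinearMap',
    LinearMap.neg_apply, neg_le_neg_iff]
  constructor
  · rintro rfl
    refine ⟨hvP, fun y hy => ?_⟩
    rcases hP y hy with rfl | h
    exacts [le_rfl, h.le]
  · rintro ⟨hx, h⟩
    exact (hP x hx).resolve_right (not_lt.2 (h v hvP))

theorem mem_normalCone_singleton {n : ℕ} {A : Finset (Fin n → ℝ)} {v : Fin n → ℝ} (hv : v ∈ A)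
    (ψ : (Fin n → ℝ) →ₗ[ℝ] ℝ) :
    ψ.domRestrict (vectorSpan ℝ (convexHull ℝ (A : Set (Fin n → ℝ)))) ∈
      normalCone (convexHull ℝ (A : Set (Fin n → ℝ))) {v} ↔ ∀ a ∈ A, 0 ≤ ψ (a - v) := by
  rw [normalCone, tangentCone, PointedCone.dual_hull, PointedCone.mem_dual]
  constructor
  · intro h a ha
    exact h (x := ⟨a - v, sub_mem_vectorSpan_convexHull ha hv⟩)
      ⟨v, rfl, a, subset_convexHull ℝ _ ha, rfl⟩
  · rintro h x ⟨w, hw, y, hy, hxy⟩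
    rw [Set.mem_singleton_iff.1 hw] at hxy
    have hconv : Convex ℝ {y | ψ v ≤ ψ y} := convex_halfSpace_ge ψ.isLinear _
    have h1 : ψ v ≤ ψ y := convexHull_min (fun a ha => by
      have := h a ha
      rw [map_sub] at this
      exact sub_nonneg.1 this) hconv hy
    change 0 ≤ ψ x
    rw [hxy, map_sub]
    linarith

/-- The normal cone at a vertex is full-dimensional, so its generators are the whole basis `b`; the
dual basis `u` then gives the edges. -/
theorem IsVertex.exists_frame {n : ℕ} {A : Finset (Fin n → ℝ)} (hA : IsLatticeConvex A)
    (hS : IsSmooth (convexHull ℝ (A : Set (Fin n → ℝ)))) {v : Fin n → ℝ} (hv : IsVertex A v) :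
    Nonempty (VertexFrame A (vectorSpan ℝ (convexHull ℝ (A : Set (Fin n → ℝ))))
      (Module.finrank ℝ (vectorSpan ℝ (convexHull ℝ (A : Set (Fin n → ℝ))))) v) := by
  classical
  set P := convexHull ℝ (A : Set (Fin n → ℝ))
  set V := vectorSpan ℝ P
  obtain ⟨m, b, s, hσ⟩ := hS _ ⟨{v}, Set.singleton_nonempty v, hv.isExposed_singleton, rfl⟩
  obtain ⟨u, hbu, hu⟩ : ∃ u : Module.Basis (Fin m) ℝ V, _ := exists_dual_edges (P := P) hA.span_lattice_eq_top b
  obtain ⟨hvA, φ, hφ⟩ := hv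
  have hm : Module.finrank ℝ V = m := by
    rw [Module.finrank_eq_card_basis u, Fintype.card_fin]
  rw [hm]
  have hcone : ∀ ψ : (Fin n → ℝ) →ₗ[ℝ] ℝ, (∀ a ∈ A, 0 ≤ ψ (a - v)) →
      ∀ j, 0 ≤ ψ (u j) ∧ (j ∉ s → ψ (u j) = 0) := by
    intro ψ hψ j
    have h1 := (mem_normalCone_singleton hvA ψ).2 hψ
    rw [hσ] at h1
    have h2 : ∀ θ ∈ PointedCone.hull ℝ ((fun i => (b i : Module.Dual ℝ V)) '' s),
        0 ≤ θ (u j) ∧ (j ∉ s → θ (u j) = 0) := by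
      intro θ hθ
      induction hθ using Submodule.span_induction with
      | mem x hx =>
        obtain ⟨i, hi, rfl⟩ := hx
        simp only [hbu]
        constructor
        · split_ifs <;> norm_num
        · intro hj
          rw [if_neg]
          rintro rfl
          exact hj hi
      | zero => simp
      | add x y _ _ hx hy =>
        exact ⟨add_nonneg hx.1 hy.1, fun h => by
          rw [LinearMap.add_apply, hx.2 h, hy.2 h, add_zero]⟩
      | smul c x _ hx =>
        exact ⟨mul_nonneg c.2 hx.1, fun h => by
          change (c : ℝ) * x (u j) = 0
          rw [hx.2 h, mul_zero]⟩
    exact h2 _ h1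
  choose β hβ using fun i => LinearMap.exists_extend (b i : Module.Dual ℝ V)
  have hβ' : ∀ i (x : V), β i x = (b i : Module.Dual ℝ V) x := fun i x =>
    LinearMap.congr_fun (hβ i) x
  have hβu : ∀ i j, β i (u j) = if i = j then 1 else 0 := fun i j => by rw [hβ', hbu]
  -- For `j ∉ s`, every functional in the cone vanishes on `u j`. But for large `K` both `φ` and `β
  -- j + K • φ` lie in it, and `β j (u j) = 1`.
  have hs : ∀ j, j ∈ s := by
    intro j
    by_contra hj
    obtain ⟨K, hK, hpos⟩ := exists_add_mul_pos A (fun a => φ (a - v)) (fun a => β j (a - v))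
    have h0 : φ (u j) = 0 := (hcone φ (fun a ha => by
      by_cases h : a = v
      · simp [h]
      · exact (hφ a ha h).le) j).2 hj
    have h1 := (hcone (β j + K • φ) (fun a ha => by
      by_cases h : a = v
      · simp [h]
      · exact (hpos a ha (hφ a ha h)).le) j).2 hj
    rw [LinearMap.add_apply, LinearMap.smul_apply, h0, hβu, if_pos rfl] at h1
    simp at h1
  have hnonneg : ∀ a ∈ A, ∀ i, 0 ≤ β i (a - v) := by
    intro a ha i
    refine (mem_normalCone_singleton hvA (β i)).1 ?_ a ha
    rw [hσ]
    have h1 : (β i).domRestrict V = (b i : Module.Dual ℝ V) := hβ i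
    rw [h1]
    exact Submodule.subset_span ⟨i, hs i, rfl⟩
  have hsum : ∀ x ∈ V, x = ∑ i, β i x • (u i : Fin n → ℝ) := by
    intro x hx
    have h1 := u.sum_repr ⟨x, hx⟩
    have h2 : ∀ i, u.repr ⟨x, hx⟩ i = β i x := by
      intro i
      have h2 := congrArg (b i : Module.Dual ℝ V) h1
      simp only [map_sum, map_smul, hbu] at h2
      rw [hβ' i ⟨x, hx⟩, ← h2]
      simp
    have h3 := congrArg Subtype.val h1
    simp only [Submodule.coe_sum, Submodule.coe_smul, h2] at h3
    exact h3.symm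
  have hint : ∀ x ∈ V, x ∈ intLattice n → ∀ i, ∃ c : ℤ, β i x = c := by
    intro x hx hxi i
    rw [hβ' i ⟨x, hx⟩]
    exact (b i).2 ⟨x, hx⟩ hxi
  refine ⟨⟨β, fun j => u j, hβu, hu, fun i => (u i).2, hsum, hint, hnonneg, fun i => ?_⟩⟩
  obtain ⟨K, hK, hpos⟩ := exists_add_mul_pos A (fun a => ∑ j ∈ univ.erase i, β j (a - v))
    (fun a => -β i (a - v))
  -- This functional is `-1` on `u i`, so it is outside the normal cone and negative at some `a -
  -- v`. By the choice of `K`, such an `a` lies on the ray `v + ℝ≥0 • u i`, at a positive integral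
  -- distance, and the segment from `v` to `a` contains `v + u i`.
  obtain ⟨a, ha, hai⟩ : ∃ a ∈ A,
      (-β i + K • ∑ j ∈ univ.erase i, β j : (Fin n → ℝ) →ₗ[ℝ] ℝ) (a - v) < 0 := by
    by_contra! h
    have h1 := (hcone _ h i).1
    simp only [LinearMap.add_apply, LinearMap.neg_apply, LinearMap.smul_apply,
      LinearMap.sum_apply, hβu] at h1
    norm_num at h1
  simp only [LinearMap.add_apply, LinearMap.neg_apply, LinearMap.smul_apply,
    LinearMap.sum_apply, smul_eq_mul] at hai
  have hnn : ∀ j ∈ univ.erase i, 0 ≤ β j (a - v) := fun j _ => hnonneg a ha j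
  have hz : ∑ j ∈ univ.erase i, β j (a - v) = 0 := by
    by_contra h
    exact absurd (hpos a ha (lt_of_le_of_ne (sum_nonneg hnn) (Ne.symm h))) (not_lt.2 hai.le)
  have hzj := (sum_eq_zero_iff_of_nonneg hnn).1 hz
  rw [hz] at hai
  have hmul : a - v = β i (a - v) • (u i : Fin n → ℝ) := by
    conv_lhs => rw [hsum _ (sub_mem_vectorSpan_convexHull ha hvA)]
    rw [← add_sum_erase _ _ (mem_univ i), sum_eq_zero, add_zero]
    intro j hj
    rw [hzj j hj, zero_smul]
  obtain ⟨c, hc⟩ := hint (a - v) (sub_mem_vectorSpan_convexHull ha hvA)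
    (intLattice_sub_mem ((hA _).1 ha).2 ((hA _).1 hvA).2) i
  have hcpos : 0 < c := by
    have : (0 : ℝ) < c := by linarith
    exact_mod_cast this
  lift c to ℕ using hcpos.le
  have h1 := hA.segment_mem (N := c) (t := 1) (u := (u i : Fin n → ℝ)) hvA (by
    convert ha using 1
    rw [hc] at hmul
    have : ((c : ℤ) : ℝ) = (c : ℝ) := by norm_cast
    rw [← this, ← hmul]
    abel) (hu i) (by omega)
  simpa using h1

/-! ### Reduction to subsets of a box -/

theorem exists_latticePoints {n k : ℕ} {P : Set (Fin n → ℝ)} (hP : IsLatticePolytope P)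
    (hk : {x | x ∈ P ∧ x ∈ intLattice n}.encard = k) :
    ∃ A : Finset (Fin n → ℝ), A.Nonempty ∧ A.card = k ∧ IsLatticeConvex A ∧
      P = convexHull ℝ (A : Set (Fin n → ℝ)) := by
  obtain ⟨S, hS, hSl, rfl⟩ := hP
  have hfin := Set.finite_of_encard_eq_coe hk
  have hsub : (S : Set (Fin n → ℝ)) ⊆ hfin.toFinset := fun x hx => by
    simpa using ⟨subset_convexHull ℝ _ hx, hSl x hx⟩
  have hhull : convexHull ℝ (S : Set (Fin n → ℝ)) = convexHull ℝ (hfin.toFinset : Set _) :=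
    (convexHull_mono hsub).antisymm (convexHull_min (fun x hx => by
      have h : x ∈ convexHull ℝ (S : Set (Fin n → ℝ)) ∧ x ∈ intLattice n := by simpa using hx
      exact h.1) (convex_convexHull ℝ _))
  refine ⟨hfin.toFinset, hS.mono (by exact_mod_cast hsub), ?_, fun x => ?_, hhull⟩
  · rw [hfin.encard_eq_coe_toFinset_card] at hk
    exact_mod_cast hk
  · rw [← hhull]
    simp

/-- The lattice points of the cube `[0, B]ᵈ`. -/
def latticeBox (d B : ℕ) : Set (Fin d → ℝ) :=
  {y | ∀ i, ∃ c : ℕ, c ≤ B ∧ y i = c}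

theorem finite_latticeBox (d B : ℕ) : (latticeBox d B).Finite := by
  have h : latticeBox d B ⊆ Set.univ.pi fun _ => (fun c : ℕ => (c : ℝ)) '' Set.Iic B := by
    intro y hy i _
    obtain ⟨c, hc, h⟩ := hy i
    exact ⟨c, hc, h.symm⟩
  exact (Set.Finite.pi' fun _ => (Set.finite_Iic B).image _).subset fun y hy i => h hy i trivial

/-- The edges form a basis of the lattice `ℤⁿ ∩ V`, so the coordinates centred at `v` identify it
with `ℤᵈ`. -/
theorem VertexFrame.integrallyEquivalent {n : ℕ} {A : Finset (Fin n → ℝ)} {d : ℕ}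
    {v : Fin n → ℝ} {P : Set (Fin n → ℝ)} (hP : P = convexHull ℝ (A : Set (Fin n → ℝ)))
    (hA : IsLatticeConvex A) (hv : v ∈ A) (F : VertexFrame A (vectorSpan ℝ P) d v) :
    IntegrallyEquivalent P
      (convexHull ℝ ((fun x i => F.coord i (x - v)) '' (A : Set (Fin n → ℝ)))) := by
  have hvP : v ∈ affineSpan ℝ P := subset_affineSpan ℝ P (hP ▸ subset_convexHull ℝ _ hv)
  have hdir : ∀ {x}, x ∈ affineSpan ℝ P → x - v ∈ vectorSpan ℝ P := fun hx => by
    rw [← direction_affineSpan]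
    exact AffineSubspace.vsub_mem_direction hx hvP
  let f : (Fin n → ℝ) →ᵃ[ℝ] (Fin d → ℝ) :=
    (LinearMap.pi F.coord).toAffineMap.comp (AffineMap.id ℝ _ - AffineMap.const ℝ _ v)
  have hf : ∀ x i, f x i = F.coord i (x - v) := fun x i => by simp [f]
  have hf' : (fun x i => F.coord i (x - v)) = f := funext fun x => funext fun i => (hf x i).symm
  have himg : f '' P = convexHull ℝ (f '' (A : Set (Fin n → ℝ))) := by
    rw [hP, f.image_convexHull]
  rw [hf', ← himg]
  refine ⟨f, ⟨?_, ?_, ?_⟩, rfl⟩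
  · rintro x ⟨hx, hxP⟩
    refine ⟨fun i => ?_, ?_⟩
    · rw [hf]
      exact F.coord_int _ (hdir hxP) (intLattice_sub_mem hx ((hA _).1 hv).2) i
    · rw [← AffineSubspace.map_span]
      exact ⟨x, hxP, rfl⟩
  · rintro x ⟨-, hx⟩ y ⟨-, hy⟩ hxy
    apply sub_left_injective (b := v)
    change x - v = y - v
    rw [F.eq_sum _ (hdir hx), F.eq_sum _ (hdir hy)]
    exact sum_congr rfl fun i _ => by rw [← hf, ← hf, hxy]
  · rintro y ⟨hy, hyP⟩
    rw [← AffineSubspace.map_span] at hyP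
    obtain ⟨x, hx, rfl⟩ := hyP
    refine ⟨x, ⟨?_, hx⟩, rfl⟩
    have hxv : x = v + (x - v) := by abel
    rw [hxv, F.eq_sum _ (hdir hx)]
    refine Submodule.add_mem _ ((hA _).1 hv).2 (Submodule.sum_mem _ fun i _ => ?_)
    obtain ⟨c, hc⟩ := hy i
    rw [hf] at hc
    rw [hc, Int.cast_smul_eq_zsmul]
    exact Submodule.smul_mem _ _ (F.edge_mem i)

/-- The image contains the origin and all unit vectors. Full dimension is what
`IntegrallyEquivalent.symm` needs in the final step. -/
theorem VertexFrame.vectorSpan_image_coord {n : ℕ} {A : Finset (Fin n → ℝ)} {d : ℕ}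
    {V : Submodule ℝ (Fin n → ℝ)} {v : Fin n → ℝ} (hv : v ∈ A) (F : VertexFrame A V d v) :
    vectorSpan ℝ (convexHull ℝ ((fun x i => F.coord i (x - v)) '' (A : Set (Fin n → ℝ)))) = ⊤ := by
  rw [vectorSpan_convexHull_eq, eq_top_iff, ← (Pi.basisFun ℝ (Fin d)).span_eq, Submodule.span_le]
  rintro _ ⟨i, rfl⟩
  have h := vsub_mem_vectorSpan ℝ
    (Set.mem_image_of_mem (fun x i => F.coord i (x - v)) (F.add_edge_mem i))
    (Set.mem_image_of_mem (fun x i => F.coord i (x - v)) hv)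
  rw [SetLike.mem_coe]
  convert h using 1
  ext j
  simp [F.coord_edge, Pi.single_apply]

theorem exists_integrallyEquivalent_box (d k : ℕ) :
    ∃ B : ℕ, ∀ P : SmoothLatticePolytope d k, ∃ T ⊆ latticeBox d B,
      vectorSpan ℝ (convexHull ℝ T) = ⊤ ∧ IntegrallyEquivalent P.carrier (convexHull ℝ T) := by
  refine ⟨⌊coordBound d k k 1⌋₊, fun ⟨n, P, hP, hd, hS, hk⟩ => ?_⟩
  obtain ⟨A, hne, hcard, hA, rfl⟩ := exists_latticePoints hP hk
  subst hd hcard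
  obtain ⟨v, hv⟩ := exists_isVertex hne
  obtain ⟨F⟩ := hv.exists_frame hA hS
  refine ⟨_, ?_, F.vectorSpan_image_coord hv.1, F.integrallyEquivalent rfl hA hv.1⟩
  rintro _ ⟨a, ha, rfl⟩ i
  obtain ⟨c, hc⟩ := F.coord_int _ (sub_mem_vectorSpan_convexHull ha hv.1)
    (intLattice_sub_mem ((hA _).1 ha).2 ((hA _).1 hv.1).2) i
  have h0 := F.coord_nonneg a ha i
  have h1 := F.coord_le hA (fun a ha b hb => sub_mem_vectorSpan_convexHull ha hb)
    (fun w hw => hw.exists_frame hA hS) hv.1 ha i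
  rw [hc] at h0 h1
  lift c to ℕ using by exact_mod_cast h0
  exact ⟨c, Nat.le_floor (by exact_mod_cast h1), by exact_mod_cast hc⟩

end SmoothPolytope

theorem mainTheorem3 (d k : ℕ) :
    Finite (Quotient (SmoothPolytope.integralEquivalence d k)) := by
  obtain ⟨B, hB⟩ := SmoothPolytope.exists_integrallyEquivalent_box d k
  choose T hT htop hPT using hB
  have := (SmoothPolytope.finite_latticeBox d B).finite_subsets.to_subtype
  -- A class is determined by the box subset of a representative: polytopes with the same subset are
  -- both equivalent to its hull.
  refine Finite.of_injective
    (β := {T : Set (Fin d → ℝ) | T ⊆ SmoothPolytope.latticeBox d B})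
    (fun q => ⟨T q.out, hT q.out⟩) fun q q' h => ?_
  have hT' : T q.out = T q'.out := congrArg Subtype.val h
  rw [← q.out_eq, ← q'.out_eq]
  refine Quotient.sound (SmoothPolytope.IntegrallyEquivalent.trans (hPT q.out) ?_)
  have hne : q'.out.carrier.Nonempty := by
    obtain ⟨S, hS, -, hP⟩ := q'.out.isLatticePolytope
    rw [hP]
    exact hS.to_set.convexHull
  rw [hT']
  refine (hPT q'.out).symm hne ?_
  rw [htop, finrank_top, q'.out.finrank_eq, Module.finrank_fin_fun]
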